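/- Let $\mathcal A$ be a unital C$^*$-algebra. Regard $\mathcal A^{**}$ as the enveloping von Neumann algebra of $\mathcal A$, i.e. the bicommutant of $\mathcal A$ in its universal representation on the Hilbert space $H_u$ (the Hilbert sum of the GNS spaces of all states of $\mathcal A$). Let $\mathcal D=\{z\in\mathcal A:\|z\|<1\}$, and let $\mathcal U(\theta)$ be the group of invertible matrices $\tilde g\in M_2(\mathcal A)$ that preserve the form $\theta(x,y)=x_1^*y_1-x_2^*y_2$ on $\mathcal A^2$. It acts on $\mathcal D$ by $\tilde g\cdot z=(g_{21}+g_{22}z)(g_{11}+g_{12}z)^{-1}$. The geodesics of $\mathcal D$ are the curves $$\delta(t)=\tilde g\cdot\left(\exp\left(t\begin{pmatrix}0&\alpha^*\\ \alpha&0\end{pmatrix}\right)\cdot 0\right),\qquad t\in\mathbb R,$$ with $\tilde g\in\mathcal U(\theta)$ and $\alpha\in\mathcal A$. An element $a\in\mathcal A^{**}$ is the $+\infty$ limit point of $\delta$ if $\delta(t)\to a$ as $t\to+\infty$ in the strong operator topology of $H_u$. 1. If $a\in\mathcal A^{**}$ is the $+\infty$ limit point of a geodesic in $\mathcal D$, then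 there are a positive invertible element $h\in\mathcal A^{**}$ and a projection $q\in\mathcal A^{**}$ such that $1-a^*a=hqh$. Consequently the defect operator $1-a^*a$ has closed range in $H_u$. 2. In particular, if $\mathcal A$ is infinite-dimensional, then not every element of norm one is such a limit point: there is $a\in\mathcal A^{**}$ with $\|a\|=1$ for which $1-a^*a$ does not have closed range, and this $a$ is not the $+\infty$ limit point of any geodesic in $\mathcal D$. -/

import Mathlib

namespace OperatorDisk

open Filter Topology

noncomputable section

universe u

/-! ### The disk of a unital C*-algebra and its geodesics -/

section Disk

variable {A : Type u} [CStarAlgebra A]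

/-- The `A`-valued form `θ(x, y) = x₁* y₁ - x₂* y₂` on `A²`. -/
def theta (x y : Fin 2 → A) : A :=
  star (x 0) * y 0 - star (x 1) * y 1

variable (A) in
/-- The unitary group `U(θ)` of the form `θ`: the invertible `2 × 2` matrices over `A` which, acting
on columns by left multiplication, preserve `θ`. -/
def thetaUnitary : Set (Matrix (Fin 2) (Fin 2) A)ˣ :=
  {g | ∀ x y : Fin 2 → A,
    theta ((g : Matrix (Fin 2) (Fin 2) A).mulVec x) ((g : Matrix (Fin 2) (Fin 2) A).mulVec y) =
      theta x y}

/-- The action by fractional linear maps, `g · z = (g₂₁ + g₂₂ z) (g₁₁ + g₁₂ z)⁻¹`. The inverse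
exists whenever `g ∈ U(θ)` and `‖z‖ < 1`. -/
def mobius (g : Matrix (Fin 2) (Fin 2) A) (z : A) : A :=
  (g 1 0 + g 1 1 * z) * Ring.inverse (g 0 0 + g 0 1 * z)

/-- The curve `t ↦ exp (t X) · 0`, `X` the matrix with rows `(0, α*)` and `(α, 0)`: the geodesic of
the disk which starts at `0` with velocity `α`. -/
def geodesicFromZero (α : A) (t : ℝ) : A :=
  mobius (NormedSpace.exp (t • (!![0, star α; α, 0] : Matrix (Fin 2) (Fin 2) A))) 0

/-- The geodesics of the disk `{z : ‖z‖ < 1}` (for the canonical connection of this homogeneous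
space of `U(θ)`): the translates by `U(θ)` of the geodesics which start at `0`. Constant geodesics
(`α = 0`) are included. -/
def IsGeodesic (δ : ℝ → A) : Prop :=
  ∃ g ∈ thetaUnitary A, ∃ α : A,
    ∀ t : ℝ, δ t = mobius (g : Matrix (Fin 2) (Fin 2) A) (geodesicFromZero α t)

end Disk

/-! ### The universal representation and the enveloping von Neumann algebra -/

section Universal

open scoped ComplexOrder

variable (A : Type u) [CStarAlgebra A] [PartialOrder A] [StarOrderedRing A]

/-- The states of `A`. -/
abbrev State : Type u := {f : A →ₚ[ℂ] ℂ // f 1 = 1}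

/-- The Hilbert space of the universal representation: the Hilbert sum of the GNS spaces of all
states of `A`. -/
abbrev UniversalSpace : Type u := lp (fun f : State A => f.1.GNS) 2

variable {A}

theorem norm_gns_le (a : A) (f : State A) : ‖f.1.gnsStarAlgHom a‖ ≤ ‖a‖ :=
  NonUnitalStarAlgHom.norm_apply_le f.1.gnsStarAlgHom a

/-- The universal representation of `A`: `a` acts on each summand by the GNS representation. -/
def universalRep (a : A) : UniversalSpace A →L[ℂ] UniversalSpace A :=
  lp.mapCLM 2 (fun f : State A => f.1.gnsStarAlgHom a) (norm_nonneg a) (norm_gns_le a)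

variable (A)

/-- The enveloping von Neumann algebra `A**`: the bicommutant of `A` in its universal
representation. -/
def Bidual : VonNeumannAlgebra (UniversalSpace A) where
  toStarSubalgebra :=
    StarSubalgebra.centralizer ℂ
      (StarSubalgebra.centralizer ℂ (Set.range (universalRep (A := A))) :
        Set (UniversalSpace A →L[ℂ] UniversalSpace A))
  centralizer_centralizer' := by
    change Set.centralizer (Set.centralizer
      ((StarSubalgebra.centralizer ℂ
        (StarSubalgebra.centralizer ℂ (Set.range (universalRep (A := A))) :
          Set (UniversalSpace A →L[ℂ] UniversalSpace A)) :
        StarSubalgebra ℂ (UniversalSpace A →L[ℂ] UniversalSpace A)) :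
        Set (UniversalSpace A →L[ℂ] UniversalSpace A))) = _
    rw [StarSubalgebra.coe_centralizer_centralizer, Set.centralizer_centralizer_centralizer]
    exact (StarSubalgebra.coe_centralizer_centralizer ℂ _).symm

variable {A}

/-- `a ∈ A**` is the limit point at `+∞` of a geodesic of the disk, the limit being taken in the
strong operator topology of the universal representation. -/
def IsLimitPoint (a : Bidual A) : Prop :=
  ∃ δ : ℝ → A, IsGeodesic δ ∧
    ∀ ξ : UniversalSpace A,
      Tendsto (fun t : ℝ => universalRep (δ t) ξ) atTop
        (𝓝 ((a : UniversalSpace A →L[ℂ] UniversalSpace A) ξ))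

end Universal

end

end OperatorDisk

/-!
The defect of a geodesic factors. Let `J = diag (1, -1)`, let `g ∈ U(θ)`, `E = exp (t X)` and
`z = g · (E · 0)`. The first column of `g E` has `θ`-length `1`, so `1 - z* z = N* N` with
`N = (g E)₀₀⁻¹`, while `g* J (g E) = J E` gives `E₀₀ N = g₀₀* - g₁₀* z = p (1 - c z)` with `p`
invertible and `‖c‖ < 1` independent of `t`. As `E₀₀ = cosh (t |α|)`, this is
`N = sech (t |α|) p (1 - c z)`. When `t → ∞`, `sech (t |α|)` tends strongly to the projection `P`
onto `ker |α|`, so a limit point `a` satisfies `1 - a* a = M* P M` with `M = p (1 - c a)`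
invertible. The polar decomposition `M = u |M|` turns this into `|M| q |M|` with `q = u* P u`.

An infinite-dimensional C*-algebra contains a self-adjoint `x` whose spectrum accumulates at some
`l`, since otherwise `1` would be a finite sum of minimal projections. Then `a = cos (x - l)` has
norm one, and the spectrum of `1 - a* a = sin² (x - l)` accumulates at `0`. In the universal
representation all spectral values are eigenvalues, and a self-adjoint operator with closed range
has no arbitrarily small nonzero eigenvalues.
-/

namespace OperatorDisk

open Filter Topology Matrix

/-! ### Strong convergence of the hyperbolic secant -/

section Sech

/-- The hyperbolic secant `1 / cosh`. Its rescalings `x ↦ sech (t * x)` interpolate between the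
constant `1` at `t = 0` and the indicator function of `{0}` as `t → ∞`. -/
noncomputable def sech (x : ℝ) : ℝ := (Real.cosh x)⁻¹

theorem differentiable_sech : Differentiable ℝ sech :=
  Real.differentiable_cosh.inv fun x => (Real.cosh_pos x).ne'

@[fun_prop]
theorem continuous_sech : Continuous sech := differentiable_sech.continuous

@[simp]
theorem sech_zero : sech 0 = 1 := by simp [sech]

theorem sech_pos (x : ℝ) : 0 < sech x := inv_pos.2 (Real.cosh_pos x)

theorem sech_le_one (x : ℝ) : sech x ≤ 1 := inv_le_one_of_one_le₀ (Real.one_le_cosh x)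

theorem norm_sech_le_one (x : ℝ) : ‖sech x‖ ≤ 1 := by
  rw [Real.norm_of_nonneg (sech_pos x).le]
  exact sech_le_one x

theorem norm_sech_mul_self_le_one (x : ℝ) : ‖sech x * x‖ ≤ 1 := by
  have abs_le_cosh : |x| ≤ Real.cosh x := by
    rw [← Real.cosh_abs]
    exact (Real.self_le_sinh_iff.2 (abs_nonneg x)).trans (Real.sinh_lt_cosh _).le
  rwa [norm_mul, Real.norm_of_nonneg (sech_pos x).le, sech, inv_mul_le_one₀ (Real.cosh_pos x)]

variable {B : Type*} [CStarAlgebra B]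

theorem norm_cfc_sech_le_one (s : B) (t : ℝ) : ‖cfc (fun x => sech (t * x)) s‖ ≤ 1 :=
  norm_cfc_le zero_le_one fun _ _ => norm_sech_le_one _

theorem cfc_sech_mul_cfc_cosh {s : B} (hs : IsSelfAdjoint s) (t : ℝ) :
    cfc (fun x => sech (t * x)) s * cfc (fun x => Real.cosh (t * x)) s = 1 := by
  rw [← cfc_mul ..]
  simp only [sech, inv_mul_cancel₀ (Real.cosh_pos _).ne']
  exact cfc_const_one ℝ s

theorem abs_mul_norm_cfc_sech_mul_le_one {s : B} (hs : IsSelfAdjoint s) (t : ℝ) :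
    |t| * ‖cfc (fun x => sech (t * x)) s * s‖ ≤ 1 := by
  have smul_eq : t • (cfc (fun x => sech (t * x)) s * s) =
      cfc (fun x => sech (t * x) * (t * x)) s := by
    rw [cfc_mul .., cfc_const_mul t (fun x => x) s, cfc_id' ℝ s, mul_smul_comm]
  rw [← Real.norm_eq_abs, ← norm_smul, smul_eq]
  exact norm_cfc_le zero_le_one fun _ _ => norm_sech_mul_self_le_one _

theorem cfc_eq_algebraMap_add_cfc_dslope_mul {f : ℝ → ℝ} (hf : Continuous f)
    (hf₀ : DifferentiableAt ℝ f 0) {s : B} (hs : IsSelfAdjoint s) :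
    cfc f s = algebraMap ℝ B (f 0) + cfc (dslope f 0) s * s := by
  have continuous_dslope : Continuous (dslope f 0) := by
    rw [← continuousOn_univ, continuousOn_dslope univ_mem]
    exact ⟨hf.continuousOn, hf₀⟩
  have apply_eq : ∀ x, f x = f 0 + dslope f 0 x * x := fun x => by
    have := sub_smul_dslope f 0 x
    rw [sub_zero, smul_eq_mul] at this
    linarith
  calc cfc f s = cfc (fun x => f 0 + dslope f 0 x * x) s := by simp only [← apply_eq]
    _ = algebraMap ℝ B (f 0) + cfc (fun x => dslope f 0 x * x) s := cfc_const_add ..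
    _ = _ := by rw [cfc_mul .., cfc_id' ℝ s]

end Sech

section Hilbert

variable {H : Type*} [NormedAddCommGroup H] [InnerProductSpace ℂ H]

theorem tendsto_apply_of_norm_le_one {ι : Type*} {F : Filter ι} {W : ι → H →L[ℂ] H}
    (hW : ∀ i, ‖W i‖ ≤ 1) {η : ι → H} {ξ ζ : H} (hη : Tendsto η F (𝓝 ξ))
    (hWξ : Tendsto (fun i => W i ξ) F (𝓝 ζ)) : Tendsto (fun i => W i (η i)) F (𝓝 ζ) := by
  have tendsto_sub : Tendsto (fun i => W i (η i - ξ)) F (𝓝 0) :=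
    squeeze_zero_norm (fun i => (W i).le_of_opNorm_le (hW i) _)
      (by simpa using (tendsto_iff_norm_sub_tendsto_zero.1 hη))
  simpa using tendsto_sub.add hWξ

variable [CompleteSpace H]

theorem tendsto_apply_starProjection_ker {ι : Type*} {F : Filter ι} {W : ι → H →L[ℂ] H}
    {T : H →L[ℂ] H} (hT : IsSelfAdjoint T) (hW : ∀ i, ‖W i‖ ≤ 1)
    (hker : ∀ i, ∀ ξ ∈ T.ker, W i ξ = ξ) (hrange : ∀ η, Tendsto (fun i => W i (T η)) F (𝓝 0))
    (ξ : H) : Tendsto (fun i => W i ξ) F (𝓝 (T.ker.starProjection ξ)) := by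
  have equicontinuous : Equicontinuous fun i => (W i : H → H) := by
    rw [show Equicontinuous (fun i => (W i : H → H)) ↔ _ from
      (NormedSpace.equicontinuous_TFAE W).out 1 5]
    exact ⟨1, hW⟩
  have orthogonal_ker_le : T.kerᗮ ≤ T.range.topologicalClosure := by
    rw [ContinuousLinearMap.orthogonal_ker, hT.adjoint_eq]
  have tendsto_orthogonal : Tendsto (fun i => W i (ξ - T.ker.starProjection ξ)) F (𝓝 0) := by
    refine closure_minimal (Set.forall_mem_range.2 hrange)
      (equicontinuous.isClosed_setOfPred_tendsto continuous_const) (orthogonal_ker_le ?_)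
    exact Submodule.sub_starProjection_mem_orthogonal ξ
  have apply_projection : ∀ i, W i (T.ker.starProjection ξ) = T.ker.starProjection ξ :=
    fun i => hker i _ (Submodule.starProjection_apply_mem _ ξ)
  simpa [apply_projection] using tendsto_orthogonal.add_const (T.ker.starProjection ξ)

theorem tendsto_cfc_sech_apply {T : H →L[ℂ] H} (hT : IsSelfAdjoint T) (ξ : H) :
    Tendsto (fun t : ℝ => cfc (fun x => sech (t * x)) T ξ) atTop
      (𝓝 (T.ker.starProjection ξ)) := by
  refine tendsto_apply_starProjection_ker hT (norm_cfc_sech_le_one T) (fun t ξ hξ => ?_)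
    (fun η => ?_) ξ
  · have differentiable : Differentiable ℝ fun x => sech (t * x) :=
      differentiable_sech.comp (differentiable_id.const_mul t)
    rw [cfc_eq_algebraMap_add_cfc_dslope_mul (by fun_prop) (differentiable 0) hT, mul_zero,
      sech_zero, map_one]
    change ξ + cfc (dslope _ 0) T (T ξ) = ξ
    rw [show T ξ = 0 from hξ, map_zero, add_zero]
  · have tendsto_bound : Tendsto (fun t : ℝ => t⁻¹ * ‖η‖) atTop (𝓝 0) := by
      simpa using tendsto_inv_atTop_zero.mul_const ‖η‖
    refine squeeze_zero_norm' ?_ tendsto_bound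
    filter_upwards [eventually_gt_atTop 0] with t ht
    refine (cfc (fun x => sech (t * x)) T * T).le_of_opNorm_le ?_ η
    rw [← one_div, le_div_iff₀' ht]
    simpa only [abs_of_pos ht] using abs_mul_norm_cfc_sech_mul_le_one hT t

end Hilbert

/-! ### Polar decomposition in von Neumann algebras -/

theorem isUnit_of_isUnit_star_mul_self {M : Type*} [Monoid M] [StarMul M] {x : M}
    (h : IsUnit (star x * x)) (h' : IsUnit (x * star x)) : IsUnit x := by
  obtain ⟨a, ha⟩ := h
  obtain ⟨b, hb⟩ := h'
  refine isUnit_iff_exists_and_exists.2 ⟨⟨star x * ↑b⁻¹, ?_⟩, ⟨↑a⁻¹ * star x, ?_⟩⟩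
  · rw [← mul_assoc, ← hb, Units.mul_inv]
  · rw [mul_assoc, ← ha, Units.inv_mul]

section Polar

variable {R : Type*}

theorem isStarProjection_conj_of_star_mul_self_eq [Ring R] [StarRing R] {p : R}
    (hp : IsStarProjection p) {u v : Rˣ} (hv : star v = v) (huv : star u * u = v * v) :
    IsStarProjection (↑v⁻¹ * (star (u : R) * p * u) * ↑v⁻¹ : R) := by
  have polar_mul_star : u * v⁻¹ * (v⁻¹ * star u) = 1 := by
    rw [mul_eq_one_comm]
    calc v⁻¹ * star u * (u * v⁻¹) = v⁻¹ * (star u * u) * v⁻¹ := by simp only [mul_assoc]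
      _ = 1 := by rw [huv]; group
  have star_inv_eq : star (↑v⁻¹ : R) = ↑v⁻¹ := by rw [← Units.coe_star, star_inv, hv]
  constructor
  · calc (↑v⁻¹ * (star (u : R) * p * u) * ↑v⁻¹ : R) * (↑v⁻¹ * (star (u : R) * p * u) * ↑v⁻¹)
        = ↑v⁻¹ * star (u : R) * p * ↑(u * v⁻¹ * (v⁻¹ * star u)) * p * u * ↑v⁻¹ := by
          simp only [Units.val_mul, Units.coe_star, mul_assoc]
      _ = ↑v⁻¹ * star (u : R) * (p * p) * u * ↑v⁻¹ := by
          rw [polar_mul_star, Units.val_one, mul_one, mul_assoc _ p p]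
      _ = _ := by rw [hp.isIdempotentElem.eq]; simp only [mul_assoc]
  · simp only [IsSelfAdjoint, star_mul, star_star, star_inv_eq, hp.isSelfAdjoint.star_eq,
      mul_assoc]

theorem isUnit_abs [CStarAlgebra R] [PartialOrder R] [StarOrderedRing R] {u : R}
    (hu : IsUnit u) : IsUnit (CFC.abs u) :=
  (CFC.isUnit_sqrt_iff _ (star_mul_self_nonneg u)).2 (hu.star.mul hu)

end Polar

theorem isClosed_range_mul_isIdempotentElem_mul {𝕜 E : Type*} [Ring 𝕜] [AddCommGroup E]
    [Module 𝕜 E] [TopologicalSpace E] [IsTopologicalAddGroup E] [T1Space E] (u v : (E →L[𝕜] E)ˣ)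
    {q : E →L[𝕜] E} (hq : IsIdempotentElem q) :
    IsClosed (Set.range (u * q * v : E →L[𝕜] E)) := by
  have range_eq : Set.range (u * q * v : E →L[𝕜] E) =
      ContinuousLinearEquiv.ofUnit u '' Set.range q := by
    rw [← Set.range_comp]
    exact (ContinuousLinearEquiv.ofUnit v).surjective.range_comp (u * q : E →L[𝕜] E)
  rw [range_eq, (ContinuousLinearEquiv.ofUnit u).isClosed_image]
  exact ContinuousLinearMap.IsIdempotentElem.isClosed_range hq

section VonNeumann

variable {H : Type*} [NormedAddCommGroup H] [InnerProductSpace ℂ H] [CompleteSpace H]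

variable (S : VonNeumannAlgebra H)

theorem mem_vonNeumannAlgebra_iff_commute {T : H →L[ℂ] H} :
    T ∈ S ↔ ∀ y ∈ S.commutant, Commute T y := by
  conv_lhs => rw [← S.commutant_commutant, VonNeumannAlgebra.mem_commutant_iff]
  exact ⟨fun h y hy => (h y hy).symm, fun h y hy => (h y hy).symm⟩

theorem units_inv_mem_vonNeumannAlgebra {u : (H →L[ℂ] H)ˣ} (hu : (u : H →L[ℂ] H) ∈ S) :
    ((u⁻¹ : (H →L[ℂ] H)ˣ) : H →L[ℂ] H) ∈ S := by
  rw [mem_vonNeumannAlgebra_iff_commute] at hu ⊢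
  exact fun y hy => (hu y hy).units_inv_left

theorem abs_mem_vonNeumannAlgebra {T : H →L[ℂ] H} (hT : T ∈ S) : CFC.abs T ∈ S := by
  have star_mul_self_mem : star T * T ∈ S := mul_mem (star_mem hT) hT
  rw [mem_vonNeumannAlgebra_iff_commute] at star_mul_self_mem ⊢
  exact fun y hy => (star_mul_self_mem y hy).cfcₙ_nnreal _

theorem starProjection_ker_mem_vonNeumannAlgebra {T : H →L[ℂ] H} (hT : T ∈ S) :
    T.ker.starProjection ∈ S := by
  rw [mem_vonNeumannAlgebra_iff_commute] at hT
  rw [VonNeumannAlgebra.IsStarProjection.mem_iff isStarProjection_starProjection]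
  intro y hy ξ hξ
  rw [Submodule.range_starProjection] at hξ ⊢
  change T (y ξ) = 0
  rw [← mul_apply_eq_comp, (hT y hy).eq, mul_apply_eq_comp,
    show T ξ = 0 from hξ, map_zero]

theorem exists_isPositive_mul_isStarProjection_mul {P M : H →L[ℂ] H} (hPS : P ∈ S)
    (hP : IsStarProjection P) (hMS : M ∈ S) (hM : IsUnit M) :
    ∃ h q : S, (h : H →L[ℂ] H).IsPositive ∧ IsUnit h ∧ IsStarProjection q ∧
      star M * P * M = h * q * h := by
  obtain ⟨u, rfl⟩ := hM
  obtain ⟨v, hv⟩ := isUnit_abs u.isUnit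
  have hvS : (v : H →L[ℂ] H) ∈ S := hv ▸ abs_mem_vonNeumannAlgebra S hMS
  have hvS' := units_inv_mem_vonNeumannAlgebra S hvS
  have v_selfAdjoint : star v = v := Units.ext (by
    rw [Units.coe_star, hv]; exact (CFC.abs_nonneg _).isSelfAdjoint)
  have star_mul_self : star u * u = v * v := Units.ext (by
    rw [Units.val_mul, Units.val_mul, Units.coe_star, hv, CFC.abs_mul_abs])
  have hq := isStarProjection_conj_of_star_mul_self_eq hP v_selfAdjoint star_mul_self
  refine ⟨⟨v, hvS⟩, ⟨_, mul_mem (mul_mem hvS' (mul_mem (mul_mem (star_mem hMS) hPS) hMS)) hvS'⟩,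
    ?_, ?_, ⟨Subtype.ext hq.isIdempotentElem, Subtype.ext hq.isSelfAdjoint⟩, ?_⟩
  · change (v : H →L[ℂ] H).IsPositive
    rw [hv, ← ContinuousLinearMap.nonneg_iff_isPositive]
    exact CFC.abs_nonneg _
  · exact ⟨⟨⟨v, hvS⟩, ⟨_, hvS'⟩, Subtype.ext v.mul_inv, Subtype.ext v.inv_mul⟩, rfl⟩
  · simp [mul_assoc]

end VonNeumann

/-! ### The group `U(θ)` and its one-parameter subgroups -/

section Disk

variable {A : Type*} [CStarAlgebra A]

variable (A) in
/-- The signature matrix `diag (1, -1)`, the Gram matrix of the form `θ`. -/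
def signature : Matrix (Fin 2) (Fin 2) A := !![1, 0; 0, -1]

theorem signature_mul_signature : signature A * signature A = 1 := by
  ext i j
  fin_cases i <;> fin_cases j <;> simp [signature, Matrix.mul_apply]

theorem theta_eq_dotProduct (x y : Fin 2 → A) : theta x y = star x ⬝ᵥ (signature A *ᵥ y) := by
  simp [theta, signature, dotProduct, Matrix.mulVec, Fin.sum_univ_two, sub_eq_add_neg]

theorem theta_mulVec_mulVec (g : Matrix (Fin 2) (Fin 2) A) (x y : Fin 2 → A) :
    theta (g *ᵥ x) (g *ᵥ y) = star x ⬝ᵥ ((gᴴ * signature A * g) *ᵥ y) := by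
  rw [theta_eq_dotProduct, star_mulVec, ← dotProduct_mulVec, mulVec_mulVec, mulVec_mulVec,
    mul_assoc]

theorem mem_thetaUnitary_iff {g : (Matrix (Fin 2) (Fin 2) A)ˣ} :
    g ∈ thetaUnitary A ↔ (g : Matrix (Fin 2) (Fin 2) A)ᴴ * signature A * g = signature A := by
  constructor
  · intro hg
    have dotProduct_single (N : Matrix (Fin 2) (Fin 2) A) (i j : Fin 2) :
        star (Pi.single i 1 : Fin 2 → A) ⬝ᵥ (N *ᵥ Pi.single j 1) = N i j := by
      rw [← Pi.single_star, star_one, mulVec_single_one, single_one_dotProduct, col_apply]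
    ext i j
    rw [← dotProduct_single (_ * _), ← theta_mulVec_mulVec, hg, theta_eq_dotProduct,
      dotProduct_single]
  · intro hg x y
    rw [theta_mulVec_mulVec, hg, theta_eq_dotProduct]

theorem mul_mem_thetaUnitary {g h : (Matrix (Fin 2) (Fin 2) A)ˣ} (hg : g ∈ thetaUnitary A)
    (hh : h ∈ thetaUnitary A) : g * h ∈ thetaUnitary A := fun x y => by
  rw [Units.val_mul, ← mulVec_mulVec, ← mulVec_mulVec, hg, hh]

section Entries

variable {g : (Matrix (Fin 2) (Fin 2) A)ˣ}

theorem star_mul_self_sub_of_mem_thetaUnitary (hg : g ∈ thetaUnitary A) :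
    star (g.val 0 0) * g.val 0 0 - star (g.val 1 0) * g.val 1 0 = 1 := by
  have := congrFun₂ (mem_thetaUnitary_iff.1 hg) 0 0
  simpa [signature, Matrix.mul_apply, Fin.sum_univ_two, ← sub_eq_add_neg] using this

theorem mul_signature_mul_conjTranspose (hg : g ∈ thetaUnitary A) :
    g.val * signature A * g.valᴴ = signature A := by
  have left_inv : signature A * g.valᴴ * signature A * g.val = 1 := by
    rw [mul_assoc, mul_assoc, ← mul_assoc g.valᴴ, mem_thetaUnitary_iff.1 hg,
      signature_mul_signature]
  calc g.val * signature A * g.valᴴ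
      = g.val * (signature A * g.valᴴ * signature A) * signature A := by
        simp only [mul_assoc, signature_mul_signature, mul_one]
    _ = g.val * g⁻¹.val * signature A := by rw [Units.eq_inv_of_mul_eq_one_right left_inv]
    _ = signature A := by rw [Units.mul_inv, one_mul]

theorem mul_star_self_sub_of_mem_thetaUnitary (hg : g ∈ thetaUnitary A) :
    g.val 0 0 * star (g.val 0 0) - g.val 0 1 * star (g.val 0 1) = 1 := by
  have := congrFun₂ (mul_signature_mul_conjTranspose hg) 0 0
  simpa [signature, Matrix.mul_apply, Fin.sum_univ_two, ← sub_eq_add_neg] using this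

theorem mobius_zero (N : Matrix (Fin 2) (Fin 2) A) : mobius N 0 = N 1 0 * Ring.inverse (N 0 0) := by
  simp [mobius]

theorem mobius_mobius_zero (N : Matrix (Fin 2) (Fin 2) A) {M : Matrix (Fin 2) (Fin 2) A}
    (hM : IsUnit (M 0 0)) : mobius N (mobius M 0) = mobius (N * M) 0 := by
  have row_eq (i : Fin 2) : N i 0 + N i 1 * (M 1 0 * Ring.inverse (M 0 0)) =
      (N * M) i 0 * Ring.inverse (M 0 0) := by
    rw [Matrix.mul_apply, Fin.sum_univ_two, add_mul, Ring.mul_inverse_cancel_right _ _ hM,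
      mul_assoc]
  rw [mobius_zero, mobius_zero, mobius, row_eq, row_eq, Ring.inverse_mul (.inr hM.ringInverse),
    Ring.inverse_inverse hM, ← mul_assoc, Ring.inverse_mul_cancel_right _ _ hM]

variable [PartialOrder A] [StarOrderedRing A]

theorem isUnit_apply_zero_zero_of_mem_thetaUnitary (hg : g ∈ thetaUnitary A) :
    IsUnit (g.val 0 0) := by
  apply isUnit_of_isUnit_star_mul_self
  · refine CStarAlgebra.isUnit_of_le 1 (sub_nonneg.1 ?_)
    rw [← star_mul_self_sub_of_mem_thetaUnitary hg, sub_sub_cancel]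
    exact star_mul_self_nonneg _
  · refine CStarAlgebra.isUnit_of_le 1 (sub_nonneg.1 ?_)
    rw [← mul_star_self_sub_of_mem_thetaUnitary hg, sub_sub_cancel]
    exact mul_star_self_nonneg _

theorem one_sub_star_mobius_zero_mul_mobius_zero (hg : g ∈ thetaUnitary A) :
    1 - star (mobius g.val 0) * mobius g.val 0 =
      star (Ring.inverse (g.val 0 0)) * Ring.inverse (g.val 0 0) := by
  obtain ⟨x, hx⟩ := isUnit_apply_zero_zero_of_mem_thetaUnitary hg
  have column := star_mul_self_sub_of_mem_thetaUnitary hg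
  have star_inv_mul : star (↑x⁻¹ : A) * star (x : A) = 1 := by
    rw [← star_mul, Units.mul_inv, star_one]
  rw [mobius_zero, ← hx, Ring.inverse_unit]
  rw [← hx] at column
  calc 1 - star (g.val 1 0 * ↑x⁻¹) * (g.val 1 0 * ↑x⁻¹)
      = (star (↑x⁻¹ : A) * star (x : A)) * (x * ↑x⁻¹) -
        star (↑x⁻¹ : A) * (star (g.val 1 0) * g.val 1 0) * ↑x⁻¹ := by
        rw [star_inv_mul, Units.mul_inv, one_mul, star_mul]
        simp only [mul_assoc]
    _ = star (↑x⁻¹ : A) * (star (x : A) * x - star (g.val 1 0) * g.val 1 0) * ↑x⁻¹ := by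
        noncomm_ring
    _ = _ := by rw [column, mul_one]

theorem norm_lt_one_of_isStrictlyPositive_one_sub_star_mul_self {u : A}
    (hu : IsStrictlyPositive (1 - star u * u)) : ‖u‖ < 1 := by
  nontriviality A
  have nonneg : 0 ≤ star u * u := star_mul_self_nonneg u
  have norm_le : ‖star u * u‖ ≤ 1 :=
    (CStarAlgebra.norm_le_one_iff_of_nonneg _ nonneg).2 (sub_nonneg.1 hu.nonneg)
  have norm_ne : ‖star u * u‖ ≠ 1 := fun norm_eq => by
    have norm_mem := CStarAlgebra.norm_mem_spectrum_of_nonneg nonneg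
    rw [norm_eq, spectrum.mem_iff, map_one] at norm_mem
    exact norm_mem hu.isUnit
  have norm_lt := lt_of_le_of_ne norm_le norm_ne
  rw [CStarRing.norm_star_mul_self, ← sq] at norm_lt
  exact (sq_lt_one_iff₀ (norm_nonneg u)).1 norm_lt

theorem norm_mobius_zero_lt_one (hg : g ∈ thetaUnitary A) : ‖mobius g.val 0‖ < 1 := by
  apply norm_lt_one_of_isStrictlyPositive_one_sub_star_mul_self
  rw [one_sub_star_mobius_zero_mul_mobius_zero hg]
  have isUnit_inverse := (isUnit_apply_zero_zero_of_mem_thetaUnitary hg).ringInverse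
  exact (isUnit_inverse.star.mul isUnit_inverse).isStrictlyPositive (star_mul_self_nonneg _)

end Entries

end Disk

section Exponential

variable {A : Type*} [CStarAlgebra A]

/-- The generator of the geodesic which starts at `0` with velocity `α`. -/
def generator (α : A) : Matrix (Fin 2) (Fin 2) A := !![0, star α; α, 0]

theorem isHermitian_generator (α : A) : (generator α).IsHermitian := by
  ext i j
  fin_cases i <;> fin_cases j <;> simp [generator]

theorem signature_mul_generator_mul_signature (α : A) :
    signature A * generator α * signature A = -generator α := by
  ext i j
  fin_cases i <;> fin_cases j <;> simp [signature, generator, Matrix.mul_apply]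

theorem mem_thetaUnitary_of_val_eq_exp {X : Matrix (Fin 2) (Fin 2) A} (hX : X.IsHermitian)
    (hJX : signature A * X * signature A = -X) {E : (Matrix (Fin 2) (Fin 2) A)ˣ}
    (hE : E.val = NormedSpace.exp X) : E ∈ thetaUnitary A := by
  let : NormedAlgebra ℚ A := NormedAlgebra.restrictScalars ℚ ℂ A
  let J : (Matrix (Fin 2) (Fin 2) A)ˣ :=
    ⟨signature A, signature A, signature_mul_signature, signature_mul_signature⟩
  have exp_neg : NormedSpace.exp (-X) = signature A * NormedSpace.exp X * signature A := by
    rw [← hJX]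
    exact exp_units_conj J X
  rw [mem_thetaUnitary_iff, hE, hX.exp.eq]
  calc NormedSpace.exp X * signature A * NormedSpace.exp X
      = signature A * (signature A * NormedSpace.exp X * signature A * NormedSpace.exp X) := by
        simp only [← mul_assoc, signature_mul_signature, one_mul]
    _ = signature A * NormedSpace.exp (-X + X) := by
        rw [← exp_neg, exp_add_of_commute _ _ (Commute.neg_left (.refl X))]
    _ = signature A := by rw [neg_add_cancel, NormedSpace.exp_zero, mul_one]

theorem exists_mem_thetaUnitary_val_eq_exp_generator (α : A) (t : ℝ) :
    ∃ E ∈ thetaUnitary A, E.val = NormedSpace.exp (t • generator α) := by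
  let : NormedAlgebra ℚ A := NormedAlgebra.restrictScalars ℚ ℂ A
  obtain ⟨E, hE⟩ := isUnit_exp (t • generator α)
  refine ⟨E, mem_thetaUnitary_of_val_eq_exp ?_ ?_ hE, hE⟩
  · exact (isHermitian_generator α).smul (.all t)
  · rw [mul_smul_comm, smul_mul_assoc, signature_mul_generator_mul_signature, smul_neg]

theorem generator_mul_generator (α : A) :
    generator α * generator α = diagonal ![star α * α, α * star α] := by
  ext i j
  fin_cases i <;> fin_cases j <;> simp [generator, Matrix.mul_apply]

theorem generator_pow_apply_zero_zero {α s : A} (hs : s * s = star α * α) (n : ℕ) :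
    (generator α ^ n) 0 0 = (2 : ℝ)⁻¹ • (s ^ n + (-s) ^ n) := by
  induction n using Nat.twoStepInduction with
  | zero => simp [← two_smul ℝ (1 : A), smul_smul]
  | one => simp [generator]
  | more n ih _ =>
    rw [add_comm n 2, pow_add, sq, generator_mul_generator, diagonal_mul, ih, mul_smul_comm,
      pow_add s, pow_add (-s), neg_sq, sq, hs, mul_add]
    simp

open scoped Matrix.Norms.Operator Nat in
theorem hasSum_exp_apply (X : Matrix (Fin 2) (Fin 2) A) (i j : Fin 2) :
    HasSum (fun n : ℕ => (n ! : ℝ)⁻¹ • (X ^ n) i j) (NormedSpace.exp X i j) := by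
  let : NormedAlgebra ℝ A := NormedAlgebra.restrictScalars ℝ ℂ A
  have : CompleteSpace (Matrix (Fin 2) (Fin 2) A) :=
    inferInstanceAs (CompleteSpace (Fin 2 → Fin 2 → A))
  have hasSum_exp : HasSum (fun n : ℕ => (n ! : ℝ)⁻¹ • X ^ n) (NormedSpace.exp X) :=
    @NormedSpace.exp_series_hasSum_exp' ℝ (Matrix (Fin 2) (Fin 2) A) _ _ _ _ _ (by exact this) X
  exact Pi.hasSum.1 (Pi.hasSum.1 hasSum_exp i) j

open scoped Nat in
theorem hasSum_cfc_exp {s : A} (hs : IsSelfAdjoint s) (t : ℝ) :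
    HasSum (fun n : ℕ => (n ! : ℝ)⁻¹ • (t • s) ^ n) (cfc (fun x => Real.exp (t * x)) s) := by
  let : NormedAlgebra ℚ A := NormedAlgebra.restrictScalars ℚ ℂ A
  rw [cfc_comp_const_mul t Real.exp s,
    CFC.real_exp_eq_normedSpace_exp (IsSelfAdjoint.smul (.all t) hs)]
  exact NormedSpace.exp_series_hasSum_exp' (𝕂 := ℝ) (t • s)

theorem exp_generator_apply_zero_zero {α s : A} (hsa : IsSelfAdjoint s) (hs : s * s = star α * α)
    (t : ℝ) :
    NormedSpace.exp (t • generator α) 0 0 = cfc (fun x => Real.cosh (t * x)) s := by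
  have cfc_cosh : cfc (fun x => Real.cosh (t * x)) s = (2 : ℝ)⁻¹ •
      (cfc (fun x => Real.exp (t * x)) s + cfc (fun x => Real.exp (-t * x)) s) := by
    rw [← cfc_add .., ← cfc_smul ..]
    congr 1
    ext x
    rw [Real.cosh_eq, smul_eq_mul, neg_mul, inv_mul_eq_div]
  rw [cfc_cosh]
  refine (hasSum_exp_apply _ 0 0).unique ?_
  convert ((hasSum_cfc_exp hsa t).add (hasSum_cfc_exp hsa (-t))).const_smul (2 : ℝ)⁻¹ using 2 with n
  rw [smul_pow, Matrix.smul_apply, generator_pow_apply_zero_zero hs, neg_smul, ← smul_neg,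
    smul_pow, smul_pow, smul_comm _ (2 : ℝ)⁻¹, smul_comm _ (2 : ℝ)⁻¹, smul_add, smul_add]

end Exponential

/-! ### Defects of limit points -/

section LimitPoint

variable {A : Type*} [CStarAlgebra A] [PartialOrder A] [StarOrderedRing A]

theorem mobius_mobius_zero_defect {g E : (Matrix (Fin 2) (Fin 2) A)ˣ} (hg : g ∈ thetaUnitary A)
    (hE : E ∈ thetaUnitary A) {w : A} (hw : w * E.val 0 0 = 1) {z : A}
    (hz : z = mobius g.val (mobius E.val 0)) :
    1 - star z * z = star (w * (star (g.val 0 0) - star (g.val 1 0) * z)) *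
      (w * (star (g.val 0 0) - star (g.val 1 0) * z)) := by
  have hgE := mul_mem_thetaUnitary hg hE
  have hz : z = mobius (g * E).val 0 := by
    rw [hz, mobius_mobius_zero _ (isUnit_apply_zero_zero_of_mem_thetaUnitary hE), Units.val_mul]
  have column_eq : star (g.val 0 0) * (g * E).val 0 0 - star (g.val 1 0) * (g * E).val 1 0 =
      E.val 0 0 := by
    have matrix_eq : g.valᴴ * signature A * (g * E).val = signature A * E.val := by
      rw [Units.val_mul, ← mul_assoc, mem_thetaUnitary_iff.1 hg]
    have := congrFun₂ matrix_eq 0 0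
    simpa [signature, Matrix.mul_apply, Fin.sum_univ_two, ← sub_eq_add_neg] using this
  have eq_inverse : w * (star (g.val 0 0) - star (g.val 1 0) * z) =
      Ring.inverse ((g * E).val 0 0) := by
    have isUnit := isUnit_apply_zero_zero_of_mem_thetaUnitary hgE
    have : star (g.val 0 0) - star (g.val 1 0) * z =
        E.val 0 0 * Ring.inverse ((g * E).val 0 0) := by
      rw [hz, mobius_zero, ← column_eq, sub_mul, Ring.mul_inverse_cancel_right _ _ isUnit,
        mul_assoc]
    rw [this, ← mul_assoc, hw, one_mul]
  rw [eq_inverse, hz, one_sub_star_mobius_zero_mul_mobius_zero hgE]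

theorem IsGeodesic.exists_defect_eq {δ : ℝ → A} (hδ : IsGeodesic δ) :
    ∃ p c s : A, IsUnit p ∧ ‖c‖ < 1 ∧ IsSelfAdjoint s ∧ ∀ t, 1 - star (δ t) * δ t =
      star (cfc (fun x => sech (t * x)) s * (p * (1 - c * δ t))) *
        (cfc (fun x => sech (t * x)) s * (p * (1 - c * δ t))) := by
  obtain ⟨g, hg, α, hδ⟩ := hδ
  have hs : IsSelfAdjoint (CFC.sqrt (star α * α)) := (CFC.sqrt_nonneg _).isSelfAdjoint
  have hg₀ := (isUnit_apply_zero_zero_of_mem_thetaUnitary hg).star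
  refine ⟨star (g.val 0 0), star (mobius g.val 0), CFC.sqrt (star α * α), hg₀,
    (norm_star _).trans_lt (norm_mobius_zero_lt_one hg), hs, fun t => ?_⟩
  obtain ⟨E, hE, hEexp⟩ := exists_mem_thetaUnitary_val_eq_exp_generator α t
  have hw : cfc (fun x => sech (t * x)) (CFC.sqrt (star α * α)) * E.val 0 0 = 1 := by
    rw [hEexp, exp_generator_apply_zero_zero hs
      (CFC.sqrt_mul_sqrt_self _ (star_mul_self_nonneg α)), cfc_sech_mul_cfc_cosh hs]
  have hδt : δ t = mobius g.val (mobius E.val 0) := by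
    rw [hδ, geodesicFromZero, hEexp, generator]
  have column_eq : star (g.val 0 0) * (1 - star (mobius g.val 0) * δ t) =
      star (g.val 0 0) - star (g.val 1 0) * δ t := by
    rw [mobius_zero, star_mul, ← Ring.inverse_star, mul_sub, mul_one, mul_assoc,
      Ring.mul_inverse_cancel_left _ _ hg₀]
  rw [column_eq]
  exact mobius_mobius_zero_defect hg hE hw hδt

theorem norm_le_one_of_one_sub_star_mul_self_eq {a b : A} (h : 1 - star a * a = star b * b) :
    ‖a‖ ≤ 1 := by
  have : ‖star a * a‖ ≤ 1 := by
    rw [CStarAlgebra.norm_le_one_iff_of_nonneg _ (star_mul_self_nonneg a), ← sub_nonneg, h]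
    exact star_mul_self_nonneg b
  rw [CStarRing.norm_star_mul_self, ← sq] at this
  exact (sq_le_one_iff₀ (norm_nonneg a)).1 this

section Operators

variable {H ι : Type*} [NormedAddCommGroup H] [InnerProductSpace ℂ H] {F : Filter ι} [F.NeBot]

theorem norm_le_of_tendsto_apply {W : ι → H →L[ℂ] H} {a : H →L[ℂ] H} {C : ℝ} (hC : 0 ≤ C)
    (hW : ∀ i, ‖W i‖ ≤ C) (h : ∀ ξ, Tendsto (fun i => W i ξ) F (𝓝 (a ξ))) : ‖a‖ ≤ C :=
  a.opNorm_le_bound hC fun ξ => le_of_tendsto' (h ξ).norm fun i => (W i).le_of_opNorm_le (hW i) ξ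

variable [CompleteSpace H]

theorem one_sub_star_mul_self_eq_of_tendsto {D N : ι → H →L[ℂ] H} {a b : H →L[ℂ] H}
    (hD : ∀ ξ, Tendsto (fun i => D i ξ) F (𝓝 (a ξ)))
    (hN : ∀ ξ, Tendsto (fun i => N i ξ) F (𝓝 (b ξ)))
    (h : ∀ i, 1 - star (D i) * D i = star (N i) * N i) : 1 - star a * a = star b * b := by
  refine ContinuousLinearMap.ext fun ξ => ext_inner_left ℂ fun η => ?_
  have inner_star_mul (x : H →L[ℂ] H) : inner ℂ η ((star x * x) ξ) = inner ℂ (x η) (x ξ) := by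
    change inner ℂ η (star x (x ξ)) = _
    rw [ContinuousLinearMap.star_eq_adjoint, ContinuousLinearMap.adjoint_inner_right]
  have inner_one_sub (x : H →L[ℂ] H) :
      inner ℂ η ((1 - star x * x) ξ) = inner ℂ η ξ - inner ℂ (x η) (x ξ) := by
    rw [← inner_star_mul, ← inner_sub_right]
    rfl
  rw [inner_one_sub, inner_star_mul]
  refine tendsto_nhds_unique (((hD η).inner (hD ξ)).const_sub _) ?_
  simp only [← inner_one_sub, h, inner_star_mul]
  exact (hN η).inner (hN ξ)

end Operators

variable {H : Type*} [NormedAddCommGroup H] [InnerProductSpace ℂ H] [CompleteSpace H]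
  (π : A →⋆ₐ[ℂ] (H →L[ℂ] H)) {δ : ℝ → A} {a : H →L[ℂ] H}

theorem IsGeodesic.exists_defect_eq_of_tendsto (hδ : IsGeodesic δ)
    (ha : ∀ ξ, Tendsto (fun t => π (δ t) ξ) atTop (𝓝 (a ξ))) :
    ∃ p c s : A, IsUnit (π p * (1 - π c * a)) ∧ 1 - star a * a =
      star (π p * (1 - π c * a)) * (π s).ker.starProjection * (π p * (1 - π c * a)) := by
  obtain ⟨p, c, s, hp, hc, hs, hdefect⟩ := hδ.exists_defect_eq
  have norm_map_le (x : A) : ‖π x‖ ≤ ‖x‖ := NonUnitalStarAlgHom.norm_apply_le π x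
  have norm_a_le : ‖a‖ ≤ 1 := norm_le_of_tendsto_apply zero_le_one (fun t =>
    (norm_map_le _).trans (norm_le_one_of_one_sub_star_mul_self_eq (hdefect t))) ha
  have norm_mul_lt : ‖π c * a‖ < 1 := by
    calc ‖π c * a‖ ≤ ‖π c‖ * ‖a‖ := norm_mul_le _ _
      _ ≤ ‖c‖ * 1 := by gcongr; exact norm_map_le c
      _ < 1 := by rwa [mul_one]
  refine ⟨p, c, s, (hp.map π).mul (isUnit_one_sub_of_norm_lt_one norm_mul_lt), ?_⟩
  have map_defect (t : ℝ) : 1 - star (π (δ t)) * π (δ t) =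
      star (cfc (fun x => sech (t * x)) (π s) * (π p * (1 - π c * π (δ t)))) *
        (cfc (fun x => sech (t * x)) (π s) * (π p * (1 - π c * π (δ t)))) := by
    have map_cfc : π (cfc (fun x => sech (t * x)) s) = cfc (fun x => sech (t * x)) (π s) :=
      StarAlgHomClass.map_cfc π _ s
    simpa only [map_mul, map_star, map_sub, map_one, map_cfc] using congrArg π (hdefect t)
  have tendsto_factor (ξ : H) : Tendsto (fun t => (π p * (1 - π c * π (δ t))) ξ) atTop
      (𝓝 ((π p * (1 - π c * a)) ξ)) :=
    ((π p).continuous.tendsto _).comp (((π c).continuous.tendsto _).comp (ha ξ) |>.const_sub ξ)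
  have tendsto_mul (ξ : H) :
      Tendsto (fun t => (cfc (fun x => sech (t * x)) (π s) * (π p * (1 - π c * π (δ t)))) ξ) atTop
        (𝓝 (((π s).ker.starProjection * (π p * (1 - π c * a))) ξ)) :=
    tendsto_apply_of_norm_le_one (norm_cfc_sech_le_one (π s)) (tendsto_factor ξ)
      (tendsto_cfc_sech_apply (hs.map π) _)
  have hP : IsStarProjection (π s).ker.starProjection := isStarProjection_starProjection
  rw [one_sub_star_mul_self_eq_of_tendsto ha tendsto_mul map_defect, star_mul,
    hP.isSelfAdjoint.star_eq, mul_assoc _ _ (_ * _), ← mul_assoc _ _ (π p * _),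
    hP.isIdempotentElem.eq, mul_assoc]

theorem IsGeodesic.exists_isPositive_of_tendsto (hδ : IsGeodesic δ) (S : VonNeumannAlgebra H)
    (hπ : ∀ x, π x ∈ S) (haS : a ∈ S)
    (ha : ∀ ξ, Tendsto (fun t => π (δ t) ξ) atTop (𝓝 (a ξ))) :
    ∃ h q : S, (h : H →L[ℂ] H).IsPositive ∧ IsUnit h ∧ IsStarProjection q ∧
      1 - star a * a = h * q * h := by
  obtain ⟨p, c, s, hM, hdefect⟩ := hδ.exists_defect_eq_of_tendsto π ha
  rw [hdefect]
  exact exists_isPositive_mul_isStarProjection_mul S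
    (starProjection_ker_mem_vonNeumannAlgebra S (hπ s)) isStarProjection_starProjection
    (mul_mem (hπ p) (sub_mem (one_mem S) (mul_mem (hπ c) haS))) hM

end LimitPoint

/-! ### Infinite-dimensional C*-algebras -/

section InfiniteSpectrum

variable {A : Type*} [CStarAlgebra A]

section OrthogonalSeries

variable {p : ℕ → A} (hp : ∀ n, IsStarProjection (p n)) {c : ℕ → ℝ} (hc : Summable c)
include hp hc

theorem summable_smul_of_isStarProjection : Summable fun n => c n • p n :=
  .of_norm_bounded hc.norm fun n => by
    rw [norm_smul]
    exact mul_le_of_le_one_right (norm_nonneg _) (hp n).norm_le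

theorem mem_spectrum_tsum_smul (orthogonal : Pairwise fun m n => p m * p n = 0) {n : ℕ}
    (hn : p n ≠ 0) : c n ∈ spectrum ℝ (∑' m, c m • p m) := by
  rw [spectrum.mem_iff]
  intro isUnit
  have tsum_mul : (∑' m, c m • p m) * p n = c n • p n := by
    rw [← (summable_smul_of_isStarProjection hp hc).tsum_mul_right, tsum_eq_single n fun m hm => by
      rw [smul_mul_assoc, orthogonal hm, smul_zero], smul_mul_assoc, (hp n).isIdempotentElem.eq]
  have : (algebraMap ℝ A (c n) - ∑' m, c m • p m) * p n = 0 := by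
    rw [sub_mul, tsum_mul, ← Algebra.smul_def, sub_self]
  exact hn (isUnit.mul_right_eq_zero.1 this)

end OrthogonalSeries

theorem exists_infinite_spectrum_of_pairwise_orthogonal {p : ℕ → A}
    (hp : ∀ n, IsStarProjection (p n)) (orthogonal : Pairwise fun m n => p m * p n = 0)
    (hne : ∀ n, p n ≠ 0) : ∃ x : A, IsSelfAdjoint x ∧ (spectrum ℝ x).Infinite := by
  refine ⟨∑' n, (1 / 2 : ℝ) ^ n • p n, ?_, ?_⟩
  · rw [IsSelfAdjoint, tsum_star]
    simp only [star_smul, (hp _).isSelfAdjoint.star_eq, star_trivial]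
  · refine Set.infinite_of_injective_forall_mem (f := fun n : ℕ => (1 / 2 : ℝ) ^ n)
      (pow_right_injective₀ (by norm_num) (by norm_num)) fun n => ?_
    exact mem_spectrum_tsum_smul hp summable_geometric_two orthogonal (hne n)

theorem exists_isStarProjection_mul_eq_smul {z : A} (hz : IsSelfAdjoint z)
    (hfin : (spectrum ℝ z).Finite) {l : ℝ} (hl : l ∈ spectrum ℝ z) :
    ∃ e : A, IsStarProjection e ∧ e ≠ 0 ∧ e * z = l • e := by
  have hcont (f : ℝ → ℝ) : ContinuousOn f (spectrum ℝ z) := hfin.continuousOn f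
  refine ⟨cfc (Pi.single l 1) z, ⟨?_, cfc_predicate _ z⟩, fun h => ?_, ?_⟩
  · rw [IsIdempotentElem, ← cfc_mul _ _ z (hcont _) (hcont _)]
    refine cfc_congr fun x _ => ?_
    simp [Pi.single_apply]
  · have := norm_apply_le_norm_cfc (Pi.single l 1) z hl (hcont _)
    rw [h, Pi.single_eq_same, norm_one, norm_zero] at this
    exact this.not_gt one_pos
  · nth_rw 2 [← cfc_id' ℝ z]
    rw [← cfc_mul _ _ z (hcont _) (hcont _), ← cfc_const_mul l _ z (hcont _)]
    refine cfc_congr fun x _ => ?_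
    by_cases hx : x = l <;> simp [hx]

theorem finiteDimensional_range_mulLeftRight {p q : A} (hp : IsStarProjection p)
    (hpA : ∀ y, ∃ c : ℂ, p * y * p = c • p) (hq : IsStarProjection q)
    (hqA : ∀ y, ∃ c : ℂ, q * y * q = c • q) :
    FiniteDimensional ℂ (LinearMap.mulLeftRight ℂ (q, p)).range := by
  by_cases h : ∀ x, q * x * p = 0
  · have : LinearMap.mulLeftRight ℂ (q, p) = 0 := LinearMap.ext fun x => by simp [h]
    rw [this, LinearMap.range_zero]
    infer_instance
  push Not at h
  obtain ⟨x, hx⟩ := h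
  refine Submodule.finiteDimensional_of_le (S₂ := Submodule.span ℂ {q * x * p}) ?_
  rintro _ ⟨y, rfl⟩
  obtain ⟨c, hc⟩ := hqA (x * p * star x)
  obtain ⟨d, hd⟩ := hpA (star x * q * y)
  have mul_star_self : q * x * p * star (q * x * p) = c • q := by
    simp only [star_mul, hp.isSelfAdjoint.star_eq, hq.isSelfAdjoint.star_eq, ← hc, mul_assoc,
      hp.isIdempotentElem.mul_self_mul]
  have hc₀ : c ≠ 0 := by
    rintro rfl
    rw [zero_smul, CStarRing.mul_star_self_eq_zero_iff] at mul_star_self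
    exact hx mul_star_self
  have smul_eq : c • (q * y * p) = d • (q * x * p) := by
    calc c • (q * y * p) = q * x * p * star (q * x * p) * (q * y * p) := by
          rw [mul_star_self, smul_mul_assoc, mul_assoc q y, hq.isIdempotentElem.mul_self_mul]
      _ = q * x * p * (p * (star x * q * y) * p) := by
          simp only [star_mul, hp.isSelfAdjoint.star_eq, hq.isSelfAdjoint.star_eq, mul_assoc,
            hp.isIdempotentElem.mul_self_mul, hq.isIdempotentElem.mul_self_mul]
      _ = d • (q * x * p) := by
          rw [hd, mul_smul_comm, mul_assoc _ p p, hp.isIdempotentElem.eq]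
  rw [LinearMap.mulLeftRight_apply, Submodule.mem_span_singleton]
  exact ⟨c⁻¹ * d, by rw [mul_smul, ← smul_eq, inv_smul_smul₀ hc₀]⟩

variable [PartialOrder A] [StarOrderedRing A]

theorem exists_infinite_spectrum_of_strictAnti {e : ℕ → A} (he : ∀ n, IsStarProjection (e n))
    (hanti : StrictAnti e) : ∃ x : A, IsSelfAdjoint x ∧ (spectrum ℝ x).Infinite := by
  have mul_right {m n : ℕ} (h : m ≤ n) : e m * e n = e n :=
    ((he n).le_iff_mul_eq_right (he m)).1 (hanti.antitone h)
  have mul_left {m n : ℕ} (h : m ≤ n) : e n * e m = e n :=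
    ((he n).le_iff_mul_eq_left (he m)).1 (hanti.antitone h)
  refine exists_infinite_spectrum_of_pairwise_orthogonal (p := fun n => e n - e (n + 1))
    (fun n => (he _).sub_of_mul_eq_left (he n) (mul_left n.le_succ)) (fun m n hmn => ?_)
    fun n => (sub_pos.2 (hanti n.lt_succ_self)).ne'
  rcases hmn.lt_or_gt with h | h
  · simp only [sub_mul, mul_sub, mul_right h.le, mul_right (Nat.le_succ_of_le h.le),
      mul_right (Nat.succ_le_of_lt h), mul_right (Nat.succ_le_succ h.le), sub_self]
  · simp only [sub_mul, mul_sub, mul_left h.le, mul_left (Nat.le_succ_of_le h.le),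
      mul_left (Nat.succ_le_of_lt h), mul_left (Nat.succ_le_succ h.le), sub_self]

/-- The minimal projections of `A`: the atoms among its projections. -/
def IsMinimalProjection (p : A) : Prop :=
  Minimal (fun e => IsStarProjection e ∧ e ≠ 0) p

theorem IsMinimalProjection.exists_eq_smul_of_isSelfAdjoint {p z : A} (hp : IsMinimalProjection p)
    (hz : IsSelfAdjoint z) (hfin : (spectrum ℝ z).Finite) (hzp : z * p = z) :
    ∃ c : ℝ, z = c • p := by
  by_cases h : spectrum ℝ z ⊆ {0}
  · exact ⟨0, by rw [zero_smul, CFC.eq_zero_of_spectrum_subset_zero (R := ℝ) z h]⟩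
  obtain ⟨l, hl, hl₀ : l ≠ 0⟩ := Set.not_subset.1 h
  obtain ⟨e, he, he₀, hez⟩ := exists_isStarProjection_mul_eq_smul hz hfin hl
  have mul_p : e * p = e := by
    rw [← inv_smul_smul₀ hl₀ e, ← hez, smul_mul_assoc, mul_assoc, hzp]
  have e_eq : e = p := hp.eq_of_le ⟨he, he₀⟩ ((he.le_iff_mul_eq_left hp.prop.1).2 mul_p)
  have star_eq := congrArg star hez
  rw [star_mul, star_smul, hz.star_eq, he.isSelfAdjoint.star_eq, star_trivial, e_eq, hzp] at star_eq
  exact ⟨l, star_eq⟩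

section FiniteSpectra

variable (hfin : ∀ x : A, IsSelfAdjoint x → (spectrum ℝ x).Finite)
include hfin

theorem wellFoundedLT_isStarProjection : WellFoundedLT {p : A // IsStarProjection p} := by
  refine ⟨wellFounded_iff_isEmpty_descending_chain.2 ⟨fun ⟨e, he⟩ => ?_⟩⟩
  obtain ⟨x, hx, infinite⟩ := exists_infinite_spectrum_of_strictAnti (fun n => (e n).2)
    (strictAnti_nat_of_succ_lt he)
  exact infinite (hfin x hx)

theorem mem_closure_isMinimalProjection {p : A} (hp : IsStarProjection p) :
    p ∈ AddSubmonoid.closure {q : A | IsMinimalProjection q} := by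
  have := wellFoundedLT_isStarProjection hfin
  suffices ∀ p : {p : A // IsStarProjection p},
      p.1 ∈ AddSubmonoid.closure {q : A | IsMinimalProjection q} from this ⟨p, hp⟩
  intro p
  induction p using WellFoundedLT.induction with
  | _ p ih =>
    by_cases hp₀ : p.1 = 0
    · rw [hp₀]
      exact zero_mem _
    by_cases hmin : IsMinimalProjection p.1
    · exact AddSubmonoid.subset_closure hmin
    have exists_lt : ∃ e : {p : A // IsStarProjection p}, e < p ∧ e.1 ≠ 0 := by
      rw [IsMinimalProjection, not_minimal_iff_exists_lt ⟨p.2, hp₀⟩] at hmin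
      obtain ⟨e, hep, he, he₀⟩ := hmin
      exact ⟨⟨e, he⟩, hep, he₀⟩
    obtain ⟨e, hep, he₀⟩ := exists_lt
    have hsub : IsStarProjection (p.1 - e.1) := (e.2.le_iff_sub p.2).1 hep.le
    have sub_lt : (⟨p - e, hsub⟩ : {p : A // IsStarProjection p}) < p :=
      sub_lt_self p.1 (lt_of_le_of_ne e.2.nonneg he₀.symm)
    rw [← sub_add_cancel p.1 e]
    exact add_mem (ih _ sub_lt) (ih e hep)

theorem IsMinimalProjection.exists_conj_eq_smul {p : A} (hp : IsMinimalProjection p) (y : A) :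
    ∃ c : ℂ, p * y * p = c • p := by
  have exists_conj_eq_smul (x : selfAdjoint A) : ∃ c : ℝ, p * x * p = c • p := by
    have hx : IsSelfAdjoint (p * x * p) := x.2.conjugate_self hp.prop.1.isSelfAdjoint
    refine hp.exists_eq_smul_of_isSelfAdjoint hx (hfin _ hx) ?_
    rw [mul_assoc, hp.prop.1.isIdempotentElem.eq]
  obtain ⟨a, ha⟩ := exists_conj_eq_smul (realPart y)
  obtain ⟨b, hb⟩ := exists_conj_eq_smul (imaginaryPart y)
  refine ⟨a + Complex.I * b, ?_⟩
  rw [← realPart_add_I_smul_imaginaryPart y, mul_add, add_mul, ha, mul_smul_comm, smul_mul_assoc,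
    hb, add_smul, mul_smul, Complex.coe_smul, Complex.coe_smul]

theorem finiteDimensional_range_mulLeftRight_of_mem_closure {q p : A}
    (hq : q ∈ AddSubmonoid.closure {q : A | IsMinimalProjection q})
    (hp : p ∈ AddSubmonoid.closure {q : A | IsMinimalProjection q}) :
    FiniteDimensional ℂ (LinearMap.mulLeftRight ℂ (q, p)).range := by
  have finiteDimensional_add {f g h : A →ₗ[ℂ] A} (hf : FiniteDimensional ℂ f.range)
      (hg : FiniteDimensional ℂ g.range) (eq : h = f + g) : FiniteDimensional ℂ h.range :=
    eq ▸ Submodule.finiteDimensional_of_le (LinearMap.range_add_le f g)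
  have finiteDimensional_zero {f : A →ₗ[ℂ] A} (eq : f = 0) : FiniteDimensional ℂ f.range := by
    rw [eq, LinearMap.range_zero]
    infer_instance
  induction hq, hp using AddSubmonoid.closure_induction₂ with
  | mem q p hq hp =>
    rw [Set.mem_ofPred_eq] at hq hp
    exact finiteDimensional_range_mulLeftRight hp.prop.1 (hp.exists_conj_eq_smul hfin) hq.prop.1
      (hq.exists_conj_eq_smul hfin)
  | zero_left => exact finiteDimensional_zero (by ext; simp)
  | zero_right => exact finiteDimensional_zero (by ext; simp)
  | add_left x y z _ _ _ hx hy => exact finiteDimensional_add hx hy (by ext; simp [add_mul])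
  | add_right x y z _ _ _ hx hy => exact finiteDimensional_add hx hy (by ext; simp [mul_add])

theorem finiteDimensional_of_finite_spectrum : FiniteDimensional ℂ A := by
  have one_mem : (1 : A) ∈ AddSubmonoid.closure {q : A | IsMinimalProjection q} :=
    mem_closure_isMinimalProjection hfin (.one A)
  have finiteDimensional_range :=
    finiteDimensional_range_mulLeftRight_of_mem_closure hfin one_mem one_mem
  have surjective : Function.Surjective (LinearMap.mulLeftRight ℂ ((1 : A), (1 : A))) :=
    fun x => ⟨x, by simp⟩
  rw [LinearMap.range_eq_top.2 surjective] at finiteDimensional_range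
  exact Submodule.topEquiv.finiteDimensional

end FiniteSpectra

end InfiniteSpectrum

/-! ### States and the universal representation -/

section PositiveFunctional

variable {E : Type*} [AddCommGroup E] [PartialOrder E] [IsOrderedAddMonoid E] [Module ℝ E]
  [PosSMulMono ℝ E]

-- M. Riesz extension of `c • e ↦ c` along the cone generated by the positive elements and `± v`.
theorem exists_positive_functional_apply_eq_zero {e v : E} (he : ∀ z, ∃ c : ℝ, 0 ≤ c • e + z)
    (hv : ∀ b c : ℝ, 0 ≤ c • e + b • v → 0 ≤ c) :
    ∃ φ : E →ₗ[ℝ] ℝ, (∀ z, 0 ≤ z → 0 ≤ φ z) ∧ φ e = 1 ∧ φ v = 0 := by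
  have he₀ : e ≠ 0 := by
    rintro rfl
    exact absurd (hv 0 (-1) (by simp)) (by norm_num)
  let C : PointedCone ℝ E := PointedCone.positive ℝ E ⊔ (Submodule.span ℝ {v}).restrictScalars _
  have mem_C {z : E} : z ∈ C ↔ ∃ b : ℝ, 0 ≤ z + b • v := by
    simp only [C, Submodule.mem_sup, Submodule.restrictScalars_mem, Submodule.mem_span_singleton,
      PointedCone.mem_positive]
    constructor
    · rintro ⟨y, hy, _, ⟨b, rfl⟩, rfl⟩
      exact ⟨-b, by simpa using hy⟩
    · rintro ⟨b, hb⟩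
      exact ⟨_, hb, _, ⟨-b, rfl⟩, by simp⟩
  obtain ⟨φ, hφ, hC⟩ := riesz_extension C (LinearPMap.mkSpanSingleton e (1 : ℝ) he₀) (by
    rintro ⟨_, hx⟩ hC
    obtain ⟨c, rfl⟩ := Submodule.mem_span_singleton.1 hx
    obtain ⟨b, hb⟩ := mem_C.1 hC
    exact (hv b c hb).trans_eq (by
      rw [LinearPMap.mkSpanSingleton'_apply, smul_eq_mul, mul_one]; rfl)) fun z => by
      obtain ⟨c, hc⟩ := he z
      exact ⟨⟨c • e, Submodule.smul_mem _ c (Submodule.mem_span_singleton_self e)⟩,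
        mem_C.2 ⟨0, by simpa using hc⟩⟩
  refine ⟨φ, fun z hz => hC z (mem_C.2 ⟨0, by simpa using hz⟩), ?_, le_antisymm ?_ ?_⟩
  · exact (hφ ⟨e, _⟩).trans (LinearPMap.mkSpanSingleton_apply ℝ ℝ he₀ 1)
  · have := hC (-v) (mem_C.2 ⟨1, by simp⟩)
    rwa [map_neg, neg_nonneg] at this
  · exact hC v (mem_C.2 ⟨-1, by simp⟩)

end PositiveFunctional

section Universal

open scoped ComplexOrder

variable {A : Type*} [CStarAlgebra A] [PartialOrder A] [StarOrderedRing A]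

theorem exists_state_of_positive_functional (φ : selfAdjoint A →ₗ[ℝ] ℝ)
    (hφ : ∀ z, 0 ≤ z → 0 ≤ φ z) (hφ₁ : φ 1 = 1) :
    ∃ f : State A, ∀ z : selfAdjoint A, f.1 z = φ z := by
  let f : A →ₗ[ℂ] ℂ := Module.Dual.extendRCLike (φ ∘ₗ realPart)
  have hf (z : selfAdjoint A) : f z = φ z := by
    simp [f, Module.Dual.extendRCLike_apply, realPart_I_smul]
  refine ⟨⟨PositiveLinearMap.mk₀ f fun z hz => ?_, ?_⟩, hf⟩
  · have := hφ ⟨z, .of_nonneg hz⟩ hz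
    rw [hf ⟨z, .of_nonneg hz⟩]
    exact_mod_cast this
  · change f (1 : selfAdjoint A) = 1
    rw [hf, hφ₁, Complex.ofReal_one]

theorem nonneg_of_nonneg_add_smul_sub {y : A} {l : ℝ} (hl : l ∈ spectrum ℝ y) {b c : ℝ}
    (h : 0 ≤ c • (1 : A) + b • (y - l • 1)) : 0 ≤ c := by
  by_contra! hc
  have le : algebraMap ℝ A (-c) ≤ b • (y - l • 1) := by
    rw [map_neg, ← sub_nonneg, sub_neg_eq_add, add_comm, Algebra.algebraMap_eq_smul_one]
    exact h
  have isUnit : IsUnit (b • (y - l • 1)) := by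
    refine CStarAlgebra.isUnit_of_le _ le ?_
    exact ((neg_pos.2 hc).ne'.isUnit.map (algebraMap ℝ A)).isStrictlyPositive
      (algebraMap_nonneg A (neg_pos.2 hc).le)
  rw [Algebra.smul_def, Commute.isUnit_mul_iff (Algebra.commutes b _), ← neg_sub, IsUnit.neg_iff,
    ← Algebra.algebraMap_eq_smul_one] at isUnit
  exact hl isUnit.2

theorem exists_state_apply_eq_of_mem_spectrum {y : A} (hy : IsSelfAdjoint y) {l : ℝ}
    (hl : l ∈ spectrum ℝ y) : ∃ f : State A, f.1 y = l := by
  have : PosSMulMono ℝ (selfAdjoint A) :=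
    ⟨fun _ hc x y h => Subtype.coe_le_coe.1 <|
      smul_le_smul_of_nonneg_left (b₁ := (x : A)) (b₂ := y) h hc⟩
  have order_unit (z : selfAdjoint A) : ∃ c : ℝ, 0 ≤ c • (1 : selfAdjoint A) + z := by
    refine ⟨‖(-z : A)‖, ?_⟩
    change (0 : A) ≤ ‖(-z : A)‖ • 1 + (z : A)
    rw [← Algebra.algebraMap_eq_smul_one, ← neg_le_iff_add_nonneg]
    exact (z.2.neg).le_algebraMap_norm_self
  obtain ⟨φ, hφ, hφ₁, hφ₀⟩ := exists_positive_functional_apply_eq_zero order_unit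
    (v := ⟨y, hy⟩ - l • 1) fun b c h => nonneg_of_nonneg_add_smul_sub hl h
  obtain ⟨f, hf⟩ := exists_state_of_positive_functional φ hφ hφ₁
  refine ⟨f, ?_⟩
  rw [map_sub, map_smul, hφ₁, smul_eq_mul, mul_one, sub_eq_zero] at hφ₀
  rw [hf ⟨y, hy⟩, hφ₀]

theorem universalRep_apply (a : A) (ξ : UniversalSpace A) (f : State A) :
    universalRep a ξ f = f.1.gnsStarAlgHom a (ξ f) := rfl

variable (A) in
/-- The universal representation as a unital star homomorphism. -/
noncomputable def universalHom : A →⋆ₐ[ℂ] (UniversalSpace A →L[ℂ] UniversalSpace A) where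
  toFun := universalRep
  map_one' := by
    ext ξ f
    rw [universalRep_apply, map_one]; rfl
  map_mul' a b := by
    ext ξ f
    rw [universalRep_apply, map_mul]; rfl
  map_zero' := by
    ext ξ f
    rw [universalRep_apply, map_zero]; rfl
  map_add' a b := by
    ext ξ f
    rw [universalRep_apply, map_add]; rfl
  commutes' c := by
    ext ξ f
    rw [universalRep_apply, AlgHomClass.commutes]; rfl
  map_star' a := by
    rw [ContinuousLinearMap.star_eq_adjoint, ContinuousLinearMap.eq_adjoint_iff]
    intro ξ η
    rw [lp.inner_eq_tsum, lp.inner_eq_tsum]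
    congr 1
    ext f
    rw [universalRep_apply, universalRep_apply, map_star, ContinuousLinearMap.star_eq_adjoint,
      ContinuousLinearMap.adjoint_inner_left]

theorem universalHom_mem_bidual (a : A) : universalHom A a ∈ Bidual A := by
  refine (StarSubalgebra.mem_centralizer_iff ℂ).2 fun y hy => ?_
  have commute := (StarSubalgebra.mem_centralizer_iff ℂ).1 hy (universalHom A a) ⟨a, rfl⟩
  refine ⟨commute.1.symm, ?_⟩
  simpa only [star_mul, star_star] using congrArg star commute.2

open Classical in
/-- The cyclic vector of the GNS representation of `f`, placed in the summand of the universal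
space that belongs to `f`. -/
noncomputable def cyclicVector (f : State A) : UniversalSpace A :=
  lp.single 2 f ((f.1.toPreGNS 1 : f.1.PreGNS) : f.1.GNS)

open Classical in
theorem universalHom_cyclicVector (a : A) (f : State A) :
    universalHom A a (cyclicVector f) =
      lp.single 2 f ((f.1.toPreGNS a : f.1.PreGNS) : f.1.GNS) := by
  ext g
  change g.1.gnsNonUnitalStarAlgHom a (cyclicVector f g) = _
  rcases eq_or_ne g f with rfl | hg
  · simp [cyclicVector]
  · simp [cyclicVector, hg]

theorem norm_universalHom_cyclicVector_sq (a : A) (f : State A) :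
    (‖universalHom A a (cyclicVector f)‖ : ℂ) ^ 2 = f.1 (star a * a) := by
  classical
  rw [universalHom_cyclicVector, lp.norm_single (by norm_num), UniformSpace.Completion.norm_coe,
    PositiveLinearMap.preGNS_norm_sq]
  rfl

theorem hasEigenvalue_universalHom {d : A} (hd : IsSelfAdjoint d) {l : ℝ}
    (hl : l ∈ spectrum ℝ d) :
    Module.End.HasEigenvalue (universalHom A d : Module.End ℂ (UniversalSpace A)) (l : ℂ) := by
  have hx : IsSelfAdjoint (d - algebraMap ℝ A l) := hd.sub (.algebraMap A (.all l))
  have zero_mem : 0 ∈ spectrum ℝ (star (d - algebraMap ℝ A l) * (d - algebraMap ℝ A l)) := by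
    rw [spectrum.zero_mem_iff, hx.star_eq, (Commute.refl _).isUnit_mul_iff, and_self, ← neg_sub,
      IsUnit.neg_iff]
    exact hl
  obtain ⟨f, hf⟩ := exists_state_apply_eq_of_mem_spectrum (.star_mul_self _) zero_mem
  have apply_eq_zero : universalHom A (d - algebraMap ℝ A l) (cyclicVector f) = 0 := by
    rw [← norm_eq_zero, ← Complex.ofReal_eq_zero, ← sq_eq_zero_iff,
      norm_universalHom_cyclicVector_sq, hf, Complex.ofReal_zero]
  have ne_zero : cyclicVector f ≠ 0 := by
    intro h
    have := norm_universalHom_cyclicVector_sq 1 f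
    simp [h, f.2] at this
  refine Module.End.hasEigenvalue_of_hasEigenvector (x := cyclicVector f) ⟨?_, ne_zero⟩
  rw [Module.End.mem_eigenspace_iff, ← sub_eq_zero, ← apply_eq_zero,
    IsScalarTower.algebraMap_apply ℝ ℂ A, map_sub, AlgHomClass.commutes]
  rfl

end Universal

/-! ### Closed range -/

section ClosedRange

theorem exists_pos_le_norm_of_hasEigenvalue {H : Type*} [NormedAddCommGroup H]
    [InnerProductSpace ℂ H] [CompleteSpace H] {d : H →L[ℂ] H} (hd : IsSelfAdjoint d)
    (hcl : IsClosed (Set.range d)) :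
    ∃ ε > 0, ∀ ν : ℂ, ν ≠ 0 → Module.End.HasEigenvalue (d : Module.End ℂ H) ν → ε ≤ ‖ν‖ := by
  have : CompleteSpace d.range := IsClosed.completeSpace_coe (hs := by rwa [LinearMap.coe_range])
  obtain ⟨C, hC, exists_preimage⟩ := ContinuousLinearMap.exists_preimage_norm_le d.rangeRestrict
    (LinearMap.surjective_rangeRestrict _)
  refine ⟨C⁻¹, inv_pos.2 hC, fun ν hν hdν => ?_⟩
  obtain ⟨w, hw⟩ := hdν.exists_hasEigenvector
  have d_apply : d w = ν • w := hw.apply_eq_smul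
  obtain ⟨x, hx, norm_x_le⟩ := exists_preimage ⟨w, ν⁻¹ • w, by
    simp [d_apply, smul_smul, inv_mul_cancel₀ hν]⟩
  have hx : d x = w := congrArg Subtype.val hx
  have norm_x_le : ‖x‖ ≤ C * ‖w‖ := norm_x_le
  have inner_eq : inner ℂ w w = inner ℂ (ν • w) x := by
    rw [← d_apply, ← hx]
    exact (hd.isSymmetric (d x) x).symm
  have norm_w_pos : 0 < ‖w‖ := norm_pos_iff.2 hw.2
  have : ‖w‖ * ‖w‖ ≤ ‖ν‖ * C * (‖w‖ * ‖w‖) := by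
    calc ‖w‖ * ‖w‖ = ‖inner ℂ (ν • w) x‖ := by
          rw [← inner_eq, inner_self_eq_norm_sq_to_K, ← sq]; simp
      _ ≤ ‖ν • w‖ * ‖x‖ := norm_inner_le_norm _ _
      _ ≤ ‖ν‖ * ‖w‖ * (C * ‖w‖) := by rw [norm_smul]; gcongr
      _ = ‖ν‖ * C * (‖w‖ * ‖w‖) := by ring
  rw [inv_le_iff_one_le_mul₀ hC]
  exact le_of_mul_le_mul_right (by rwa [one_mul]) (mul_pos norm_w_pos norm_w_pos)

theorem accPt_map_of_tendsto {X Y : Type*} [TopologicalSpace X] [TopologicalSpace Y] {f : X → Y}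
    {x : X} {y : Y} {F : Filter X} (h : AccPt x F) (hf : Tendsto f (𝓝[≠] x) (𝓝[≠] y)) :
    AccPt y (F.map f) :=
  (NeBot.map h f).mono (map_inf_le.trans (inf_le_inf_right _ hf))

variable {A : Type*} [CStarAlgebra A]

theorem exists_accPt_spectrum (hA : ¬ FiniteDimensional ℂ A) :
    ∃ x : A, IsSelfAdjoint x ∧ ∃ l ∈ spectrum ℝ x, AccPt l (𝓟 (spectrum ℝ x)) := by
  let _ := CStarAlgebra.spectralOrder A
  have := CStarAlgebra.spectralOrderedRing A
  obtain ⟨x, hx, infinite⟩ : ∃ x : A, IsSelfAdjoint x ∧ (spectrum ℝ x).Infinite := by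
    by_contra! h
    exact hA (finiteDimensional_of_finite_spectrum h)
  obtain ⟨l, hl, hacc⟩ := infinite.exists_accPt_of_subset_isCompact
    (ContinuousFunctionalCalculus.isCompact_spectrum x) subset_rfl
  exact ⟨x, hx, l, hl, hacc⟩

theorem accPt_spectrum_cfc_sin_sq {x : A} (hx : IsSelfAdjoint x) {l : ℝ}
    (hl : AccPt l (𝓟 (spectrum ℝ x))) :
    AccPt 0 (𝓟 (spectrum ℝ (cfc (fun y => Real.sin (y - l) ^ 2) x))) := by
  rw [cfc_map_spectrum _ x, ← Filter.map_principal]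
  refine accPt_map_of_tendsto hl (tendsto_nhdsWithin_iff.2 ⟨?_, ?_⟩)
  · have : Continuous fun y => Real.sin (y - l) ^ 2 := by fun_prop
    simpa using (this.tendsto l).mono_left nhdsWithin_le_nhds
  · have hasDerivAt : HasDerivAt (fun y => Real.sin (y - l)) 1 l := by
      simpa using ((hasDerivAt_id l).sub_const l).sin
    exact (hasDerivAt.eventually_ne one_ne_zero).mono fun y hy => pow_ne_zero 2 hy

theorem one_sub_star_cfc_cos_mul_cfc_cos {x : A} (hx : IsSelfAdjoint x) (l : ℝ) :
    1 - star (cfc (fun y => Real.cos (y - l)) x) * cfc (fun y => Real.cos (y - l)) x =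
      cfc (fun y => Real.sin (y - l) ^ 2) x := by
  have : IsSelfAdjoint (cfc (fun y => Real.cos (y - l)) x) := cfc_predicate _ x
  rw [this.star_eq, ← cfc_mul _ _ x, ← cfc_const_one ℝ x, ← cfc_sub _ _ x]
  simp only [Real.sin_sq, ← sq]

variable {H : Type*} [NormedAddCommGroup H] [InnerProductSpace ℂ H] [CompleteSpace H]
  {π : A →⋆ₐ[ℂ] (H →L[ℂ] H)}
  (hπ : ∀ d : A, IsSelfAdjoint d → ∀ l ∈ spectrum ℝ d,
    Module.End.HasEigenvalue (π d : Module.End ℂ H) (l : ℂ))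

include hπ

theorem not_isClosed_range_of_accPt_zero {d : A} (hd : IsSelfAdjoint d)
    (hacc : AccPt 0 (𝓟 (spectrum ℝ d))) : ¬ IsClosed (Set.range (π d)) := by
  intro hcl
  obtain ⟨ε, hε, le_norm⟩ := exists_pos_le_norm_of_hasEigenvalue (hd.map π) hcl
  obtain ⟨l, ⟨hl, hl₀⟩, l_lt⟩ :=
    ((accPt_iff_frequently.1 hacc).and_eventually (Metric.ball_mem_nhds 0 hε)).exists
  refine (le_norm l (Complex.ofReal_ne_zero.2 hl) (hπ d hd l hl₀)).not_gt ?_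
  simpa using l_lt

theorem norm_le_norm_map_of_mem_spectrum {d : A} (hd : IsSelfAdjoint d) {l : ℝ}
    (hl : l ∈ spectrum ℝ d) : ‖l‖ ≤ ‖π d‖ := by
  obtain ⟨w, hw⟩ := (hπ d hd l hl).exists_hasEigenvector
  have := (π d).le_opNorm w
  rw [show π d w = (l : ℂ) • w from hw.apply_eq_smul, norm_smul, Complex.norm_real] at this
  exact le_of_mul_le_mul_right this (norm_pos_iff.2 hw.2)

theorem exists_norm_eq_one_not_isClosed_range (hA : ¬ FiniteDimensional ℂ A) :
    ∃ a : A, ‖π a‖ = 1 ∧ ¬ IsClosed (Set.range (1 - star (π a) * π a : H →L[ℂ] H)) := by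
  obtain ⟨x, hx, l, hl, hacc⟩ := exists_accPt_spectrum hA
  refine ⟨cfc (fun y => Real.cos (y - l)) x, le_antisymm ?_ ?_, ?_⟩
  · exact (NonUnitalStarAlgHom.norm_apply_le π _).trans
      (norm_cfc_le zero_le_one fun y _ => Real.abs_cos_le_one _)
  · have one_mem : 1 ∈ spectrum ℝ (cfc (fun y => Real.cos (y - l)) x) := by
      rw [cfc_map_spectrum _ x]
      exact ⟨l, hl, by simp⟩
    simpa using norm_le_norm_map_of_mem_spectrum hπ (cfc_predicate _ x) one_mem
  · rw [← map_star, ← map_mul, ← map_one π, ← map_sub, one_sub_star_cfc_cos_mul_cfc_cos hx]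
    exact not_isClosed_range_of_accPt_zero hπ (cfc_predicate _ x)
      (accPt_spectrum_cfc_sin_sq hx hacc)

end ClosedRange

section LimitPoint

variable {A : Type*} [CStarAlgebra A] [PartialOrder A] [StarOrderedRing A] {a : Bidual A}

theorem IsLimitPoint.exists_isPositive (ha : IsLimitPoint a) :
    ∃ h q : Bidual A, (h : UniversalSpace A →L[ℂ] UniversalSpace A).IsPositive ∧ IsUnit h ∧
      IsStarProjection q ∧ 1 - star a * a = h * q * h := by
  obtain ⟨δ, hδ, hlim⟩ := ha
  obtain ⟨h, q, h_pos, h_unit, hq, hdefect⟩ := hδ.exists_isPositive_of_tendsto (universalHom A)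
    (Bidual A) universalHom_mem_bidual a.2 hlim
  exact ⟨h, q, h_pos, h_unit, hq, Subtype.ext hdefect⟩

theorem IsLimitPoint.isClosed_range (ha : IsLimitPoint a) :
    IsClosed (Set.range ((1 - star a * a : Bidual A) :
      UniversalSpace A →L[ℂ] UniversalSpace A)) := by
  obtain ⟨h, q, -, h_unit, hq, hdefect⟩ := ha.exists_isPositive
  obtain ⟨u, hu⟩ := h_unit.map (Bidual A).toStarSubalgebra.subtype
  rw [hdefect]
  change u = (h : UniversalSpace A →L[ℂ] UniversalSpace A) at hu
  have := isClosed_range_mul_isIdempotentElem_mul u u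
    (hq.isIdempotentElem.map (Bidual A).toStarSubalgebra.subtype)
  rwa [hu] at this

end LimitPoint

end OperatorDisk

theorem proposition7 {A : Type*} [CStarAlgebra A] [PartialOrder A] [StarOrderedRing A] :
    (∀ a : OperatorDisk.Bidual A, OperatorDisk.IsLimitPoint a →
      (∃ h q : OperatorDisk.Bidual A,
        (h : OperatorDisk.UniversalSpace A →L[ℂ] OperatorDisk.UniversalSpace A).IsPositive ∧
        IsUnit h ∧ IsStarProjection q ∧ 1 - star a * a = h * q * h) ∧
      IsClosed (Set.range ((1 - star a * a : OperatorDisk.Bidual A) :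
        OperatorDisk.UniversalSpace A →L[ℂ] OperatorDisk.UniversalSpace A))) ∧
    (¬ FiniteDimensional ℂ A →
      ∃ a : OperatorDisk.Bidual A,
        ‖(a : OperatorDisk.UniversalSpace A →L[ℂ] OperatorDisk.UniversalSpace A)‖ = 1 ∧
        ¬ IsClosed (Set.range ((1 - star a * a : OperatorDisk.Bidual A) :
          OperatorDisk.UniversalSpace A →L[ℂ] OperatorDisk.UniversalSpace A)) ∧
        ¬ OperatorDisk.IsLimitPoint a) := by
  refine ⟨fun a ha => ⟨ha.exists_isPositive, ha.isClosed_range⟩, fun hA => ?_⟩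
  obtain ⟨a, norm_eq, not_isClosed⟩ := OperatorDisk.exists_norm_eq_one_not_isClosed_range
    (π := OperatorDisk.universalHom A) (fun _ hd _ => OperatorDisk.hasEigenvalue_universalHom hd) hA
  exact ⟨⟨_, OperatorDisk.universalHom_mem_bidual a⟩, norm_eq, not_isClosed,
    fun ha => not_isClosed ha.isClosed_range⟩
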